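/- A positive integer $N$ has the \emph{Lehmer property} if it is composite (that is, $N>1$ and $N$ is not prime) and $\varphi(N)\mid N-1$, where $\varphi$ is Euler's totient function. For every integer $n\ge 1$, the Cullen number $C_n=n\cdot 2^n+1$ does not have the Lehmer property. Equivalently, if $n\ge 1$ and $\varphi(C_n)\mid C_n-1$, then $C_n$ is prime. -/

import Mathlib

/-- The `n`-th Cullen number `C_n = n * 2 ^ n + 1`. -/
def cullenNumber (n : ℕ) : ℕ := n * 2 ^ n + 1

/-- A positive integer has the Lehmer property if it is composite and its Euler totient
divides its predecessor. The subtraction is a genuine one, because `1 < N`. -/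
def HasLehmerProperty (N : ℕ) : Prop :=
  (1 < N ∧ ¬ N.Prime) ∧ Nat.totient N ∣ N - 1

/-! Write N = A·2^M + 1 with A odd; for a Cullen number, A ≤ n ≤ M. A Lehmer number is squarefree,
so with p - 1 = μ_p·2^κ_p the product ∏(p - 1) divides A·2^M and ∏ μ_p divides A. Since p ≤ 2(p -
1), this forces M < Σ(κ_p + 1) (`lt_sum_factorization`).

Yet each prime p = m·2^k + 1 dividing N tends to have small k. Modulo p both m·2^k and A·2^M are -1;
raising the former to a power q ≈ M/k shows that p divides m^q·2^u ± A·2^v with u, v small. If this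
is nonzero, k is O(√M·log m), or O(log A) when m = 1. As Σ log μ_p ≤ log A, the sum is O(√M·log M),
too small once M ≥ 256.

If it vanishes, (p - 1)^q = A·2^M with q odd. At most one p does this, and q ≥ 3 because N is not
prime, so κ_p ≤ M/3 and the estimate survives. For n < 256 a kernel computation bounds the sum. -/

/-! ### Divisors m·2^k + 1 of A·2^M + 1 -/

theorem dvd_pow_mul_add_pow_mul {A M m k q u v : ℕ} (h : m * 2 ^ k + 1 ∣ A * 2 ^ M + 1)
    (hM : M + u = q * k + v) :
    ((m * 2 ^ k + 1 : ℕ) : ℤ) ∣ (m : ℤ) ^ q * 2 ^ u + (-1) ^ q * (A * 2 ^ v) := by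
  have h1 : ((m * 2 ^ k + 1 : ℕ) : ℤ) ∣ (A : ℤ) * 2 ^ M + 1 := by exact_mod_cast h
  have h2 : ((m * 2 ^ k + 1 : ℕ) : ℤ) ∣ ((m : ℤ) * 2 ^ k) ^ q - (-1) ^ q := by
    have := sub_dvd_pow_sub_pow ((m : ℤ) * 2 ^ k) (-1) q
    rwa [sub_neg_eq_add] at this
  have h3 : (2 : ℤ) ^ M * 2 ^ u = (2 ^ k) ^ q * 2 ^ v := by
    rw [← pow_add, hM, pow_add, ← pow_mul, mul_comm k q]
  have h4 : (m : ℤ) ^ q * 2 ^ u + (-1) ^ q * (A * 2 ^ v) =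
      2 ^ u * (m : ℤ) ^ q * (A * 2 ^ M + 1) - A * 2 ^ v * (((m : ℤ) * 2 ^ k) ^ q - (-1) ^ q) := by
    rw [mul_pow]
    linear_combination (-(A : ℤ) * m ^ q) * h3
  rw [h4]
  exact dvd_sub (h1.mul_left _) (h2.mul_left _)

/-- A divisor `m * 2 ^ k + 1` of `A * 2 ^ M + 1` is either small in terms of an approximation
`q` of `M / k`, or `A * 2 ^ M` is an odd power of `m * 2 ^ k`. -/
theorem le_add_or_odd_pow {A M m k q u v : ℕ} (hA : Odd A) (hm : Odd m)
    (h : m * 2 ^ k + 1 ∣ A * 2 ^ M + 1) (hM : M + u = q * k + v) (huv : u = 0 ∨ v = 0) :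
    m * 2 ^ k + 1 ≤ m ^ q * 2 ^ u + A * 2 ^ v ∨ Odd q ∧ M = q * k ∧ m ^ q = A := by
  have hd := dvd_pow_mul_add_pow_mul h hM
  rcases eq_or_ne ((m : ℤ) ^ q * 2 ^ u + (-1) ^ q * (A * 2 ^ v)) 0 with h0 | h0
  · right
    have hA0 := hA.pos
    have hm0 := hm.pos
    have hq : Odd q := by
      by_contra hq
      rw [Nat.not_odd_iff_even] at hq
      rw [hq.neg_one_pow] at h0
      have : (0 : ℤ) < (m : ℤ) ^ q * 2 ^ u + 1 * (A * 2 ^ v) := by positivity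
      omega
    rw [hq.neg_one_pow] at h0
    have he : m ^ q * 2 ^ u = A * 2 ^ v := by
      have : (m : ℤ) ^ q * 2 ^ u = A * 2 ^ v := by linarith
      exact_mod_cast this
    have hmq : Odd (m ^ q) := hm.pow
    -- Since m^q and A are odd, comparing powers of two gives u = v.
    have huv0 : u = 0 ∧ v = 0 := by
      rcases huv with rfl | rfl
      · refine ⟨rfl, ?_⟩
        by_contra hv
        rw [pow_zero, mul_one] at he
        rw [he] at hmq
        exact (Nat.not_odd_iff_even.mpr ((Nat.even_pow.mpr ⟨even_two, hv⟩).mul_left A)) hmq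
      · refine ⟨?_, rfl⟩
        by_contra hu
        rw [pow_zero, mul_one] at he
        rw [← he] at hA
        exact (Nat.not_odd_iff_even.mpr ((Nat.even_pow.mpr ⟨even_two, hu⟩).mul_left _)) hA
    obtain ⟨rfl, rfl⟩ := huv0
    exact ⟨hq, by simpa using hM, by simpa using he⟩
  · left
    have h1 := Int.le_of_dvd (abs_pos.mpr h0) ((dvd_abs _ _).mpr hd)
    have h2 : |(m : ℤ) ^ q * 2 ^ u + (-1) ^ q * (A * 2 ^ v)| ≤ (m : ℤ) ^ q * 2 ^ u + A * 2 ^ v := by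
      refine (abs_add_le _ _).trans (le_of_eq ?_)
      rw [abs_mul ((-1) ^ q), abs_pow, abs_neg, abs_one, one_pow, one_mul,
        abs_of_nonneg (by positivity), abs_of_nonneg (by positivity)]
    exact_mod_cast h1.trans h2

/-- Both p - 1 and q - 1 are odd powers of a common c, and c + 1 divides c^e + 1 for odd e;
primality forces p = c + 1 = q. -/
theorem Nat.Prime.eq_of_pred_pow_eq_pred_pow {p q a b : ℕ} (hp : p.Prime) (hq : q.Prime)
    (ha : Odd a) (hb : Odd b) (h : (p - 1) ^ a = (q - 1) ^ b) : p = q := by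
  obtain ⟨c, hpc, hqc⟩ := Nat.exists_eq_pow_of_pow_eq_pow (Or.inl ha.pos.ne') h
  have key : ∀ {r e : ℕ}, r.Prime → Odd e → r - 1 = c ^ e → c + 1 = r := by
    intro r e hr he hrc
    have hr2 := hr.two_le
    have hd : c + 1 ∣ r := by
      have := he.nat_add_dvd_pow_add_pow c 1
      rwa [one_pow, ← hrc, Nat.sub_add_cancel (by omega)] at this
    rcases (Nat.dvd_prime hr).mp hd with h1 | h1
    · obtain rfl : c = 0 := by omega
      rw [zero_pow he.pos.ne'] at hrc
      omega
    · exact h1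
  have hb' : Odd (b / a.gcd b) := hb.of_dvd_nat (Nat.div_dvd_of_dvd (Nat.gcd_dvd_right a b))
  have ha' : Odd (a / a.gcd b) := ha.of_dvd_nat (Nat.div_dvd_of_dvd (Nat.gcd_dvd_left a b))
  exact (key hp hb' hpc).symm.trans (key hq ha' hqc)

/-! ### Consequences of the Lehmer property -/

theorem Nat.squarefree_of_totient_dvd_sub_one {N : ℕ} (hN : 0 < N) (h : N.totient ∣ N - 1) :
    Squarefree N := by
  rw [Nat.squarefree_iff_prime_squarefree]
  intro p hp hpN
  have h1 : p ∣ (p * p).totient := by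
    rw [Nat.totient_mul_of_prime_of_dvd hp dvd_rfl]
    exact dvd_mul_right _ _
  have h2 : p ∣ N - 1 := (h1.trans (Nat.totient_dvd_of_dvd hpN)).trans h
  have h3 : p ∣ N := (dvd_mul_right p p).trans hpN
  have h4 := (Nat.dvd_sub_iff_right hN h3).mp h2
  exact hp.one_lt.ne' (Nat.dvd_one.mp h4)

theorem Squarefree.totient_eq_prod {N : ℕ} (hN : Squarefree N) :
    N.totient = ∏ p ∈ N.primeFactors, (p - 1) := by
  have h := Nat.totient_mul_prod_primeFactors N
  rw [Nat.prod_primeFactors_of_squarefree hN, mul_comm] at h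
  exact Nat.eq_of_mul_eq_mul_left hN.ne_zero.bot_lt h

theorem HasLehmerProperty.squarefree {N : ℕ} (h : HasLehmerProperty N) : Squarefree N :=
  Nat.squarefree_of_totient_dvd_sub_one (zero_lt_one.trans h.1.1) h.2

theorem HasLehmerProperty.prod_ordCompl_dvd {A M : ℕ}
    (h : HasLehmerProperty (A * 2 ^ M + 1)) :
    ∏ p ∈ (A * 2 ^ M + 1).primeFactors, ordCompl[2] (p - 1) ∣ A := by
  have h1 : ∏ p ∈ (A * 2 ^ M + 1).primeFactors, ordCompl[2] (p - 1) ∣ A * 2 ^ M := by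
    have := h.2
    rw [h.squarefree.totient_eq_prod, Nat.add_sub_cancel] at this
    exact (Finset.prod_dvd_prod_of_dvd _ _ fun p _ => Nat.ordCompl_dvd (p - 1) 2).trans this
  refine Nat.Coprime.dvd_of_dvd_mul_right (Nat.Coprime.pow_right _ ?_) h1
  refine Nat.Coprime.prod_left fun p hp => ?_
  have := (Nat.prime_of_mem_primeFactors hp).two_le
  exact (Nat.coprime_ordCompl Nat.prime_two (by omega)).symm

/-- The exponents of two in the numbers `p - 1` are large on average. -/
theorem HasLehmerProperty.lt_sum_factorization {A M : ℕ} (hA : Odd A)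
    (h : HasLehmerProperty (A * 2 ^ M + 1)) :
    M < ∑ p ∈ (A * 2 ^ M + 1).primeFactors, ((p - 1).factorization 2 + 1) := by
  have h1 : A * 2 ^ M < A *
      2 ^ (∑ p ∈ (A * 2 ^ M + 1).primeFactors, ((p - 1).factorization 2 + 1)) := by
    calc A * 2 ^ M < A * 2 ^ M + 1 := Nat.lt_succ_self _
      _ = ∏ p ∈ (A * 2 ^ M + 1).primeFactors, p :=
        (Nat.prod_primeFactors_of_squarefree h.squarefree).symm
      _ ≤ ∏ p ∈ (A * 2 ^ M + 1).primeFactors,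
          (ordCompl[2] (p - 1) * 2 ^ ((p - 1).factorization 2 + 1)) := by
        refine Finset.prod_le_prod' fun p hp => ?_
        have h2 := (Nat.prime_of_mem_primeFactors hp).two_le
        calc p ≤ (p - 1) * 2 := by omega
          _ = _ := by
            conv_lhs => rw [← Nat.ordProj_mul_ordCompl_eq_self (p - 1) 2]
            ring
      _ = (∏ p ∈ (A * 2 ^ M + 1).primeFactors, ordCompl[2] (p - 1)) *
          2 ^ (∑ p ∈ (A * 2 ^ M + 1).primeFactors, ((p - 1).factorization 2 + 1)) := by
        rw [Finset.prod_mul_distrib, Finset.prod_pow_eq_pow_sum]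
      _ ≤ _ := Nat.mul_le_mul_right _ (Nat.le_of_dvd hA.pos h.prod_ordCompl_dvd)
  exact (Nat.pow_lt_pow_iff_right one_lt_two).mp (Nat.lt_of_mul_lt_mul_left h1)

/-! ### Real estimates -/

theorem three_halves_le_logb_two {m : ℕ} (hm : 3 ≤ m) : (3 / 2 : ℝ) ≤ Real.logb 2 m := by
  have h2 : 0 < Real.log 2 := Real.log_pos one_lt_two
  rw [Real.logb, le_div_iff₀ h2]
  have h3 : Real.log 3 ≤ Real.log m := Real.log_le_log (by norm_num) (by exact_mod_cast hm)
  have h4 : Real.log ((2 : ℝ) ^ 3) ≤ Real.log ((3 : ℝ) ^ 2) :=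
    Real.log_le_log (by norm_num) (by norm_num)
  rw [Real.log_pow, Real.log_pow] at h4
  push_cast at h4
  linarith

/-- Tangent line at w = 4, that is at 256 = 4^4: the slope is 1/log 2 < 1.443 and the intercept 8 -
4/log 2 < 2.23. -/
theorem logb_two_pow_four_le {w : ℝ} (hw : 4 ≤ w) :
    Real.logb 2 (w ^ 4) ≤ 1.443 * w + 2.23 := by
  have h2 := Real.log_two_gt_d9
  have h3 : Real.log (w / 4) ≤ w / 4 - 1 := Real.log_le_sub_one_of_pos (by positivity)
  rw [Real.log_div (by positivity) (by norm_num), show (4 : ℝ) = 2 ^ 2 by norm_num,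
    Real.log_pow] at h3
  rw [Real.logb, div_le_iff₀ (by linarith), Real.log_pow]
  push_cast at h3 ⊢
  nlinarith

theorem exists_nearest_multiple (M : ℕ) {k : ℕ} (hk : 0 < k) :
    ∃ q u v : ℕ, M + u = q * k + v ∧ (u = 0 ∨ v = 0) ∧ 2 * u ≤ k ∧ 2 * v ≤ k := by
  have h1 := Nat.div_add_mod' M k
  have h2 := Nat.mod_lt M hk
  rcases le_total (2 * (M % k)) k with h | h
  · exact ⟨M / k, 0, M % k, by omega, Or.inl rfl, by omega, h⟩
  · exact ⟨M / k + 1, k - M % k, 0, by rw [add_mul]; omega, Or.inr rfl, by omega, by omega⟩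

/-- The exponent of two is bounded by the logarithm of the odd part, when an approximation
of `M / k` by `q` gives a nontrivial inequality. -/
theorem exponent_add_one_le {A M m k q u v : ℕ} {w : ℝ} (hw : 4 ≤ w) (hwM : w ^ 4 = M)
    (hA0 : 0 < A) (hA : Real.logb 2 A ≤ 1.443 * w + 2.23) (hm : 3 ≤ m)
    (hM : M + u = q * k + v) (hu : 2 * u ≤ k) (hv : 2 * v ≤ k)
    (h : m * 2 ^ k + 1 ≤ m ^ q * 2 ^ u + A * 2 ^ v) :
    (k + 1 : ℝ) ≤ (1.16 * w ^ 2 + 1) * Real.logb 2 m := by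
  have hl := three_halves_le_logb_two hm
  set l := Real.logb 2 m with hldef
  have hm0 : (m : ℝ) ≠ 0 := by positivity
  have hA0' : (A : ℝ) ≠ 0 := by positivity
  have hk0 : (0 : ℝ) ≤ k := by positivity
  have hu' : (2 : ℝ) * u ≤ k := by exact_mod_cast hu
  have hv' : (2 : ℝ) * v ≤ k := by exact_mod_cast hv
  have hv0 : (0 : ℝ) ≤ v := by positivity
  have hM' : (M : ℝ) + u = q * k + v := by exact_mod_cast hM
  have hlog2 : Real.logb 2 2 = 1 := Real.logb_self_eq_one one_lt_two
  have hmk : Real.logb 2 ((m : ℝ) * 2 ^ k) = l + k := by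
    rw [Real.logb_mul hm0 (by positivity), Real.logb_pow, hlog2, mul_one]
  rcases le_total (m * 2 ^ k) (2 * (A * 2 ^ v)) with h1 | h1
  · have h2 : Real.logb 2 ((m : ℝ) * 2 ^ k) ≤ Real.logb 2 (2 * ((A : ℝ) * 2 ^ v)) :=
      Real.logb_le_logb_of_le one_lt_two (by positivity) (by exact_mod_cast h1)
    rw [hmk, Real.logb_mul two_ne_zero (by positivity), Real.logb_mul hA0' (by positivity),
      Real.logb_pow, hlog2, mul_one] at h2
    nlinarith
  · have h3 : m * 2 ^ k ≤ 2 * (m ^ q * 2 ^ u) := by omega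
    have h2 : Real.logb 2 ((m : ℝ) * 2 ^ k) ≤ Real.logb 2 (2 * ((m : ℝ) ^ q * 2 ^ u)) :=
      Real.logb_le_logb_of_le one_lt_two (by positivity) (by exact_mod_cast h3)
    rw [hmk, Real.logb_mul two_ne_zero (by positivity), Real.logb_mul (by positivity)
      (by positivity), Real.logb_pow, Real.logb_pow, hlog2, mul_one, ← hldef] at h2
    -- Multiplying by k eliminates q through qk = M + u - v, leaving a quadratic inequality in k.
    have h4 : (k : ℝ) * (k / 2 - 1) ≤ (M - k / 2) * l := by
      have h5 : (k : ℝ) * (k / 2 - 1) ≤ k * ((q - 1) * l) :=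
        mul_le_mul_of_nonneg_left (by linarith) hk0
      have h6 : (k : ℝ) * ((q - 1) * l) = (M + u - v - k) * l := by
        rw [show (M : ℝ) + u - v - k = k * (q - 1) by linarith]; ring
      have h7 : (M + u - v - k) * l ≤ (M - k / 2) * l :=
        mul_le_mul_of_nonneg_right (by linarith) (by linarith)
      linarith
    have h8 : (k - 1 / 4 : ℝ) ^ 2 ≤ 4 / 3 * (w ^ 2 * l) ^ 2 + 1 / 16 := by
      have h9 : (k : ℝ) * (3 / 2) ≤ k * l := mul_le_mul_of_nonneg_left hl hk0
      have h10 : (M : ℝ) * l * (3 / 2) ≤ M * l * l :=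
        mul_le_mul_of_nonneg_left hl (by positivity)
      have h11 : (w ^ 2 * l) ^ 2 = M * l * l := by rw [← hwM]; ring
      rw [h11]
      nlinarith
    -- The constant 1.16 exceeds √(4/3); the extra l ≥ 3/2 absorbs the lower-order terms.
    by_contra! hc
    have hz : 0 ≤ w ^ 2 * l := by positivity
    have h12 : 1.16 * (w ^ 2 * l) + 1 / 4 ≤ (k : ℝ) - 1 / 4 := by linarith
    have h13 := pow_le_pow_left₀ (by positivity) h12 2
    nlinarith

/-- The factor 3/2 bounds q/(q - 1) for q ≥ 3, as the exceptional prime requires. -/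
theorem quartic_bound {w L : ℝ} (hw : 4 ≤ w) (hL0 : 0 ≤ L) (hL : L ≤ 1.443 * w + 2.23) :
    (1.16 * w ^ 2 + 1) * L + 3 / 2 * (1 + (L + 2) * (L + 3) / 2) ≤ w ^ 4 := by
  have h1 : (1.16 * w ^ 2 + 1) * L + 3 / 2 * (1 + (L + 2) * (L + 3) / 2) ≤
      (1.16 * w ^ 2 + 1) * (1.443 * w + 2.23) +
        3 / 2 * (1 + (1.443 * w + 2.23 + 2) * (1.443 * w + 2.23 + 3) / 2) := by
    gcongr
  refine h1.trans ?_
  obtain ⟨x, rfl⟩ : ∃ x, w = 4 + x := ⟨w - 4, by ring⟩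
  have hx : 0 ≤ x := by linarith
  have h2 := pow_nonneg hx 2
  have h3 := pow_nonneg hx 3
  have h4 := pow_nonneg hx 4
  nlinarith

/-! ### The contradiction for M ≥ 256 -/

/-- A prime factor of a Lehmer number `A * 2 ^ M + 1` satisfies a nontrivial inequality for every
approximation `q` of `M / k`, or `A * 2 ^ M` is an odd power of its predecessor. -/
theorem HasLehmerProperty.le_add_or_odd_pow {A M p q u v : ℕ} (hA : Odd A)
    (h : HasLehmerProperty (A * 2 ^ M + 1)) (hp : p ∈ (A * 2 ^ M + 1).primeFactors)
    (hM : M + u = q * (p - 1).factorization 2 + v) (huv : u = 0 ∨ v = 0) :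
    ordCompl[2] (p - 1) * 2 ^ (p - 1).factorization 2 + 1 ≤
        ordCompl[2] (p - 1) ^ q * 2 ^ u + A * 2 ^ v ∨
      ∃ q, Odd q ∧ 3 ≤ q ∧ M = q * (p - 1).factorization 2 ∧ ordCompl[2] (p - 1) ^ q = A := by
  have hpp := Nat.prime_of_mem_primeFactors hp
  have hp2 := hpp.two_le
  have hpN := Nat.dvd_of_mem_primeFactors hp
  have hodd : Odd (ordCompl[2] (p - 1)) := by
    rw [← Nat.not_even_iff_odd, even_iff_two_dvd]
    exact Nat.not_dvd_ordCompl Nat.prime_two (by omega)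
  have he : ordCompl[2] (p - 1) * 2 ^ (p - 1).factorization 2 + 1 = p := by
    rw [mul_comm, Nat.ordProj_mul_ordCompl_eq_self]
    omega
  rcases _root_.le_add_or_odd_pow hA hodd (by rwa [he]) hM huv with h1 | ⟨h1, h2, h3⟩
  · exact Or.inl h1
  · refine Or.inr ⟨q, h1, ?_, h2, h3⟩
    have h4 : q ≠ 1 := by
      rintro rfl
      rw [pow_one] at h3
      rw [one_mul] at h2
      rw [h3, ← h2] at he
      exact h.1.2 (he ▸ hpp)
    obtain ⟨r, rfl⟩ := h1
    omega

theorem sum_range_succ_add_one (K : ℕ) :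
    ∑ k ∈ Finset.range (K + 1), ((k : ℝ) + 1) = (K + 1) * (K + 2) / 2 := by
  induction K with
  | zero => norm_num
  | succ K ih => rw [Finset.sum_range_succ, ih]; push_cast; ring

/-- The primes of the form `2 ^ k + 1` with bounded `k` contribute little. -/
theorem sum_factorization_le_of_fermat {A : ℕ} (T : Finset ℕ)
    (hT : ∀ p ∈ T, p.Prime ∧ ordCompl[2] (p - 1) = 1 ∧ 2 ^ ((p - 1).factorization 2 - 1) ≤ A) :
    ∑ p ∈ T, (((p - 1).factorization 2 : ℝ) + 1) ≤
      (Real.logb 2 A + 2) * (Real.logb 2 A + 3) / 2 := by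
  rcases T.eq_empty_or_nonempty with rfl | ⟨p₀, hp₀⟩
  · have h0 : 0 ≤ Real.logb 2 A := by
      rcases Nat.eq_zero_or_pos A with rfl | hA
      · simp
      · exact Real.logb_nonneg one_lt_two (by exact_mod_cast hA)
    rw [Finset.sum_empty]
    positivity
  have hA : A ≠ 0 := by
    have := (hT p₀ hp₀).2.2
    have h2 : 0 < 2 ^ ((p₀ - 1).factorization 2 - 1) := by positivity
    omega
  have hinj : Set.InjOn (fun p : ℕ => (p - 1).factorization 2) T := by
    intro p hp q hq hpq
    have hp1 := hT p hp
    have hq1 := hT q hq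
    have h1 := Nat.ordProj_mul_ordCompl_eq_self (p - 1) 2
    have h2 := Nat.ordProj_mul_ordCompl_eq_self (q - 1) 2
    rw [hp1.2.1] at h1
    rw [hq1.2.1] at h2
    simp only at hpq
    rw [hpq] at h1
    have := hp1.1.two_le
    have := hq1.1.two_le
    omega
  have hsub : T.image (fun p : ℕ => (p - 1).factorization 2) ⊆
      Finset.range (Nat.log 2 A + 1 + 1) := by
    intro k hk
    obtain ⟨p, hp, rfl⟩ := Finset.mem_image.mp hk
    have := Nat.le_log_of_pow_le one_lt_two (hT p hp).2.2
    rw [Finset.mem_range]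
    omega
  calc ∑ p ∈ T, (((p - 1).factorization 2 : ℝ) + 1)
      = ∑ k ∈ T.image (fun p : ℕ => (p - 1).factorization 2), ((k : ℝ) + 1) :=
        (Finset.sum_image hinj (f := fun k : ℕ => (k : ℝ) + 1)).symm
    _ ≤ ∑ k ∈ Finset.range (Nat.log 2 A + 1 + 1), ((k : ℝ) + 1) :=
        Finset.sum_le_sum_of_subset_of_nonneg hsub fun _ _ _ => by positivity
    _ = (Nat.log 2 A + 2) * (Nat.log 2 A + 3) / 2 := by
        rw [sum_range_succ_add_one]; push_cast; ring
    _ ≤ _ := by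
        have := Real.natLog_le_logb A 2
        push_cast at this
        have h0 : (0 : ℝ) ≤ Nat.log 2 A := by positivity
        refine div_le_div_of_nonneg_right (mul_le_mul ?_ ?_ ?_ ?_) zero_le_two <;> linarith

theorem not_hasLehmerProperty_of_le {A M : ℕ} (hA : Odd A) (hAM : A ≤ M) (hM : 256 ≤ M) :
    ¬ HasLehmerProperty (A * 2 ^ M + 1) := by
  classical
  intro h
  have hA0 := hA.pos
  obtain ⟨w, hw, hwM⟩ : ∃ w : ℝ, 4 ≤ w ∧ w ^ 4 = M := by
    refine ⟨√√M, ?_, ?_⟩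
    · refine Real.le_sqrt_of_sq_le (Real.le_sqrt_of_sq_le ?_)
      norm_num
      exact_mod_cast hM
    · rw [show 4 = 2 * 2 by norm_num, pow_mul, Real.sq_sqrt (by positivity),
        Real.sq_sqrt (by positivity)]
  have hL : Real.logb 2 A ≤ 1.443 * w + 2.23 :=
    (Real.logb_le_logb_of_le one_lt_two (by positivity) (by exact_mod_cast hAM)).trans
      (hwM ▸ logb_two_pow_four_le hw)
  have hL0 : 0 ≤ Real.logb 2 A := Real.logb_nonneg one_lt_two (by exact_mod_cast hA0)
  set S := (A * 2 ^ M + 1).primeFactors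
  set κ : ℕ → ℕ := fun p => (p - 1).factorization 2
  set μ : ℕ → ℕ := fun p => ordCompl[2] (p - 1)
  set C : ℝ := 1.16 * w ^ 2 + 1 with hC
  set L := Real.logb 2 A with hLdef
  let special : ℕ → Prop := fun p => ∃ q, Odd q ∧ 3 ≤ q ∧ M = q * κ p ∧ μ p ^ q = A
  have hμodd : ∀ p ∈ S, Odd (μ p) := fun p hp => by
    have := (Nat.prime_of_mem_primeFactors hp).two_le
    rw [← Nat.not_even_iff_odd, even_iff_two_dvd]
    exact Nat.not_dvd_ordCompl Nat.prime_two (by omega)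
  have hl0 : ∀ p ∈ S, 0 ≤ Real.logb 2 (μ p) := fun p hp =>
    Real.logb_nonneg one_lt_two (by exact_mod_cast (hμodd p hp).pos)
  have hκ0 : ∀ p ∈ S, 0 < κ p := fun p hp => by
    have hpp := Nat.prime_of_mem_primeFactors hp
    have hpN := Nat.dvd_of_mem_primeFactors hp
    have hNodd : Odd (A * 2 ^ M + 1) :=
      ((Nat.even_pow.mpr ⟨even_two, by omega⟩).mul_left A).add_one
    have := hNodd.of_dvd_nat hpN
    have := hpp.two_le
    exact Nat.prime_two.factorization_pos_of_dvd (by omega) (by grind)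
  have hsumlog : ∑ p ∈ S, Real.logb 2 (μ p) ≤ L := by
    rw [← Real.logb_prod _ _ fun p hp => by exact_mod_cast (hμodd p hp).pos.ne']
    refine Real.logb_le_logb_of_le one_lt_two ?_ ?_
    · exact Finset.prod_pos fun p hp => by exact_mod_cast (hμodd p hp).pos
    · exact_mod_cast Nat.le_of_dvd hA0 h.prod_ordCompl_dvd
  have hfermat : ∀ p ∈ S, ¬ special p → μ p = 1 → 2 ^ (κ p - 1) ≤ A := by
    intro p hp hs h1
    have hk := hκ0 p hp
    -- Here M / κ is rounded up, so that v = 0 and A is not multiplied by a power of two; then u ≤ κ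
    -- - 1.
    have h2 := Nat.div_add_mod' (M + (κ p - 1)) (κ p)
    have h3 := Nat.mod_lt (M + (κ p - 1)) hk
    have h4 : M + (κ p - 1 - (M + (κ p - 1)) % κ p) = (M + (κ p - 1)) / κ p * κ p + 0 := by omega
    rcases h.le_add_or_odd_pow hA hp h4 (Or.inr rfl) with h5 | h5
    · change μ p * 2 ^ κ p + 1 ≤ μ p ^ _ * _ + _ at h5
      rw [h1, one_pow, one_mul, one_mul, pow_zero, mul_one] at h5
      have h6 : 2 ^ (κ p - 1 - (M + (κ p - 1)) % κ p) ≤ 2 ^ (κ p - 1) :=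
        Nat.pow_le_pow_right two_pos (Nat.sub_le _ _)
      have h7 : 2 ^ κ p = 2 * 2 ^ (κ p - 1) := by
        rw [← pow_succ', Nat.sub_add_cancel hk]
      omega
    · exact absurd h5 hs
  have hlarge : ∀ p ∈ S, ¬ special p → μ p ≠ 1 → (κ p + 1 : ℝ) ≤ C * Real.logb 2 (μ p) := by
    intro p hp hs h1
    obtain ⟨q, u, v, h2, h3, h4, h5⟩ := exists_nearest_multiple M (hκ0 p hp)
    have h6 : 3 ≤ μ p := by
      obtain ⟨r, hr⟩ := hμodd p hp
      omega
    rcases h.le_add_or_odd_pow hA hp h2 h3 with h7 | h7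
    · exact exponent_add_one_le hw hwM hA0 hL h6 h2 h4 h5 h7
    · exact absurd h7 hs
  have hC0 : 0 ≤ C := by positivity
  have hordinary : ∑ p ∈ S with ¬ special p, (κ p + 1 : ℝ) ≤
      C * ∑ p ∈ S with ¬ special p, Real.logb 2 (μ p) + (L + 2) * (L + 3) / 2 := by
    rw [← Finset.sum_filter_add_sum_filter_not _ (fun p => μ p = 1) (fun p => (κ p + 1 : ℝ)),
      add_comm, Finset.mul_sum]
    refine add_le_add ?_ ?_
    · refine (Finset.sum_le_sum (g := fun p => C * Real.logb 2 (μ p)) fun p hp => ?_).trans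
        (Finset.sum_le_sum_of_subset_of_nonneg (Finset.filter_subset _ _) fun p hp _ => ?_)
      · simp only [Finset.mem_filter] at hp
        exact hlarge p hp.1.1 hp.1.2 hp.2
      · exact mul_nonneg hC0 (hl0 p (Finset.mem_of_mem_filter p hp))
    · refine sum_factorization_le_of_fermat _ fun p hp => ?_
      simp only [Finset.mem_filter] at hp
      exact ⟨Nat.prime_of_mem_primeFactors hp.1.1, hp.2, hfermat p hp.1.1 hp.1.2 hp.2⟩
  have hsum : (M : ℝ) < ∑ p ∈ S, (κ p + 1 : ℝ) := by
    exact_mod_cast h.lt_sum_factorization hA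
  rw [← Finset.sum_filter_add_sum_filter_not _ special] at hsum hsumlog
  have hquartic := quartic_bound hw hL0 hL
  rw [hwM, ← hC] at hquartic
  rcases (S.filter special).eq_empty_or_nonempty with he | ⟨p, hp⟩
  · rw [he, Finset.sum_empty, zero_add] at hsum hsumlog
    have h1 := mul_le_mul_of_nonneg_left hsumlog hC0
    have h2 : 0 ≤ (L + 2) * (L + 3) / 2 := by positivity
    linarith
  · have hpow : ∀ p q, p ∈ S → M = q * κ p → μ p ^ q = A → (p - 1) ^ q = A * 2 ^ M := by
      intro p q _ h1 h2
      rw [← Nat.ordProj_mul_ordCompl_eq_self (p - 1) 2, mul_pow, ← pow_mul]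
      change 2 ^ (κ p * q) * μ p ^ q = _
      rw [h2, mul_comm (κ p), ← h1, mul_comm]
    have hsing : S.filter special = {p} := by
      refine Finset.eq_singleton_iff_unique_mem.mpr ⟨hp, fun p' hp' => ?_⟩
      rw [Finset.mem_filter] at hp hp'
      obtain ⟨hpS, q, h1, -, h2, h3⟩ := hp
      obtain ⟨hpS', q', h1', -, h2', h3'⟩ := hp'
      exact (Nat.prime_of_mem_primeFactors hpS').eq_of_pred_pow_eq_pred_pow
        (Nat.prime_of_mem_primeFactors hpS) h1' h1
        ((hpow p' q' hpS' h2' h3').trans (hpow p q hpS h2 h3).symm)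
    rw [hsing, Finset.sum_singleton] at hsum hsumlog
    obtain ⟨hpS, q, -, hq3, h2, h3⟩ := Finset.mem_filter.mp hp
    have hq3' : (3 : ℝ) ≤ q := by exact_mod_cast hq3
    have hMq : (M : ℝ) = q * κ p := by exact_mod_cast h2
    have hLq : L = q * Real.logb 2 (μ p) := by
      rw [hLdef, ← h3, Nat.cast_pow, Real.logb_pow]
    have h4 : C * ∑ p ∈ S with ¬ special p, Real.logb 2 (μ p) ≤ C * (L - Real.logb 2 (μ p)) :=
      mul_le_mul_of_nonneg_left (by linarith) hC0
    -- With x = κ - C·log₂ μ and E = 1 + (L + 2)(L + 3)/2: (q - 1)x < E, whereas qx = M - CL ≥ 3E/2,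
    -- impossible for q ≥ 3.
    have h6 : ((q : ℝ) - 1) * (κ p - C * Real.logb 2 (μ p)) < 1 + (L + 2) * (L + 3) / 2 := by
      rw [hLq] at h4
      nlinarith
    have h7 : (q : ℝ) * (κ p - C * Real.logb 2 (μ p)) = M - C * L := by
      rw [hMq, hLq]; ring
    have h8 : 0 < 1 + (L + 2) * (L + 3) / 2 := by positivity
    have h9 : 0 < κ p - C * Real.logb 2 (μ p) := by
      by_contra! hc
      have := mul_nonpos_of_nonneg_of_nonpos (by positivity : (0 : ℝ) ≤ q) hc
      linarith
    have h10 := mul_nonneg h9.le (sub_nonneg.mpr hq3')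
    linarith

/-! ### Finite check for n < 256 -/

/-- `∑ k < n, f k`. -/
def sumBelow (f : ℕ → ℕ) (n : ℕ) : ℕ := Nat.rec 0 (fun k s => f k + s) n

theorem sumBelow_eq_sum (f : ℕ → ℕ) (n : ℕ) : sumBelow f n = ∑ k ∈ Finset.range n, f k := by
  induction n with
  | zero => rfl
  | succ n ih => rw [Finset.sum_range_succ, ← ih, Nat.add_comm (sumBelow f n)]; rfl

/-- The sum of `k + 1` over the proper divisors `m * 2 ^ k + 1` of `N`, with `m` an odd divisor
of `n` and `k < n + 8`. -/
def properDivisorWeight (n N : ℕ) : ℕ :=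
  sumBelow (fun m => bif (n % m).beq 0 && (m % 2).beq 1 then
    sumBelow (fun k => bif (N % (m * 2 ^ k + 1)).beq 0 && !((m * 2 ^ k + 1).beq N)
      then k + 1 else 0) (n + 8) else 0) (n + 1)

/-- A sum of failure indicators, built from `Nat.rec` and Boolean tests so that the kernel can
evaluate it. -/
theorem sum_properDivisorWeight :
    sumBelow (fun n => bif (properDivisorWeight n (n * 2 ^ n + 1)).ble n then 0 else 1) 256 = 0 := by
  decide +kernel

theorem properDivisorWeight_le {n : ℕ} (hn : n < 256) :
    properDivisorWeight n (n * 2 ^ n + 1) ≤ n := by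
  have h := sum_properDivisorWeight
  rw [sumBelow_eq_sum, Finset.sum_eq_zero_iff] at h
  have h1 := h n (Finset.mem_range.mpr hn)
  by_contra hc
  have h2 : (properDivisorWeight n (n * 2 ^ n + 1)).ble n = false := by
    rw [Bool.eq_false_iff, ne_eq, Nat.ble_eq]
    exact hc
  rw [h2] at h1
  exact absurd h1 (by decide)

theorem sum_le_properDivisorWeight {n N : ℕ} (T : Finset (ℕ × ℕ))
    (hT : ∀ x ∈ T, x.1 ∣ n ∧ Odd x.1 ∧ x.1 ≤ n ∧ x.2 < n + 8 ∧ x.1 * 2 ^ x.2 + 1 ∣ N ∧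
      x.1 * 2 ^ x.2 + 1 ≠ N) :
    ∑ x ∈ T, (x.2 + 1) ≤ properDivisorWeight n N := by
  let g : ℕ → ℕ → ℕ := fun m k => bif (n % m).beq 0 && (m % 2).beq 1 then
    (bif (N % (m * 2 ^ k + 1)).beq 0 && !((m * 2 ^ k + 1).beq N) then k + 1 else 0) else 0
  have hg : properDivisorWeight n N =
      ∑ x ∈ Finset.range (n + 1) ×ˢ Finset.range (n + 8), g x.1 x.2 := by
    rw [properDivisorWeight, sumBelow_eq_sum, Finset.sum_product]
    refine Finset.sum_congr rfl fun m _ => ?_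
    cases hb : (n % m).beq 0 && (m % 2).beq 1
    · simp [g, hb]
    · simp [g, hb, sumBelow_eq_sum]
  rw [hg]
  calc ∑ x ∈ T, (x.2 + 1) = ∑ x ∈ T, g x.1 x.2 := by
        refine Finset.sum_congr rfl fun x hx => ?_
        obtain ⟨h1, h2, -, -, h3, h4⟩ := hT x hx
        have h5 : (x.1 * 2 ^ x.2 + 1).beq N = false := by
          rw [Bool.eq_false_iff, ne_eq, Nat.beq_eq]
          exact h4
        simp [g, Nat.mod_eq_zero_of_dvd h1, Nat.mod_eq_zero_of_dvd h3, Nat.odd_iff.mp h2, h5]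
    _ ≤ _ := by
        refine Finset.sum_le_sum_of_subset fun x hx => ?_
        obtain ⟨-, -, h1, h2, -⟩ := hT x hx
        simp only [Finset.mem_product, Finset.mem_range]
        omega

theorem mainTheorem1 (n : ℕ) (hn : 1 ≤ n) : ¬ HasLehmerProperty (cullenNumber n) := by
  obtain ⟨a, A, hA, hnA⟩ := Nat.exists_eq_two_pow_mul_odd (n := n) (by omega)
  have hAn : A ∣ n := hnA ▸ dvd_mul_left _ _
  have hAle : A ≤ n := Nat.le_of_dvd hn hAn
  have hN : cullenNumber n = A * 2 ^ (n + a) + 1 := by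
    rw [cullenNumber, pow_add]
    conv_lhs => rw [mul_comm]
    nth_rw 2 [hnA]
    ring
  rcases lt_or_ge n 256 with hlt | hge
  · intro h
    rw [hN] at h
    have h1 := h.lt_sum_factorization hA
    have h2 := properDivisorWeight_le hlt
    have hprod := h.prod_ordCompl_dvd
    set S := (A * 2 ^ (n + a) + 1).primeFactors
    have heq : ∀ p ∈ S, ordCompl[2] (p - 1) * 2 ^ (p - 1).factorization 2 + 1 = p := by
      intro p hp
      have := (Nat.prime_of_mem_primeFactors hp).two_le
      rw [mul_comm, Nat.ordProj_mul_ordCompl_eq_self]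
      omega
    let f : ℕ → ℕ × ℕ := fun p => (ordCompl[2] (p - 1), (p - 1).factorization 2)
    have hinj : Set.InjOn f S := by
      intro p hp q hq hpq
      rw [← heq p hp, ← heq q hq]
      have h3 := congrArg Prod.fst hpq
      have h4 := congrArg Prod.snd hpq
      simp only [f] at h3 h4
      rw [h3, h4]
    have h3 : ∑ p ∈ S, ((p - 1).factorization 2 + 1) ≤
        properDivisorWeight n (n * 2 ^ n + 1) := by
      rw [← Finset.sum_image (f := fun x : ℕ × ℕ => x.2 + 1) hinj]
      refine sum_le_properDivisorWeight _ fun x hx => ?_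
      obtain ⟨p, hp, rfl⟩ := Finset.mem_image.mp hx
      have hpp := Nat.prime_of_mem_primeFactors hp
      have hp2 := hpp.two_le
      have hpN : p ∣ n * 2 ^ n + 1 := by
        rw [← cullenNumber, hN]
        exact Nat.dvd_of_mem_primeFactors hp
      have hd : ordCompl[2] (p - 1) ∣ n := ((Finset.dvd_prod_of_mem _ hp).trans hprod).trans hAn
      have hodd : Odd (ordCompl[2] (p - 1)) := by
        rw [← Nat.not_even_iff_odd, even_iff_two_dvd]
        exact Nat.not_dvd_ordCompl Nat.prime_two (by omega)
      refine ⟨hd, hodd, Nat.le_of_dvd hn hd, ?_, ?_, ?_⟩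
      -- The 8 in the range of exponents comes from n < 2^8.
      · have h4 : 2 ^ (p - 1).factorization 2 ≤ n * 2 ^ n :=
          (Nat.le_of_dvd (by omega) (Nat.ordProj_dvd (p - 1) 2)).trans (by
            have := Nat.le_of_dvd (Nat.succ_pos _) hpN
            omega)
        have h5 : n * 2 ^ n < 2 ^ (n + 8) := by
          rw [pow_add, mul_comm]
          exact Nat.mul_lt_mul_of_pos_left (by omega) (by positivity)
        exact (Nat.pow_lt_pow_iff_right one_lt_two).mp (h4.trans_lt h5)
      · exact (heq p hp).symm ▸ hpN
      · change ordCompl[2] (p - 1) * 2 ^ (p - 1).factorization 2 + 1 ≠ n * 2 ^ n + 1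
        rw [heq p hp, ← cullenNumber, hN]
        rintro rfl
        exact h.1.2 hpp
    have h4 : n < ∑ p ∈ S, ((p - 1).factorization 2 + 1) := by
      exact (Nat.le_add_right n a).trans_lt h1
    omega
  · rw [hN]
    exact not_hasLehmerProperty_of_le hA (by omega) (by omega)
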